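/- Let $\alpha$ be a countable ordinal. Then there exist a countable compact metric space $X$ and a homeomorphism $T\colon X\to X$ such that the derived degree of $X$, the van der Waerden depth of $(X,T)$ and the (Birkhoff) depth of $(X,T)$ are all equal to $\alpha$: $$d(X)=\mathrm{depth}^{(\infty)}(X,T)=\mathrm{depth}(X,T)=\alpha .$$ Here the following definitions are used. (i) $X^{(0)}=X$; $X^{(\beta+1)}$ is the set of accumulation points of the space $X^{(\beta)}$; and $X^{(\lambda)}=\bigcap_{\beta<\lambda}X^{(\beta)}$ for limit ordinals $\lambda$. One writes $d(X)=\alpha$ if $X^{(\alpha)}\neq\emptyset$ and $X^{(\alpha+1)}=\emptyset$. (ii) For a closed set $A\subseteq X$ with $T(A)\subseteq A$, $\Omega(A,T)$ is the set of points $x\in A$ such that for every neighbourhood $V$ of $x$ in $A$ there is an integer $n\ge 1$ with $V\cap T^{-n}V\neq\emptyset$, and $\Omega^{(\infty)}(A,T)$ is the set of points $x\in A$ such that for every neighbourhood $V$ of $x$ in $A$ and every integer $d\ge 1$ there is an integer $k\ge 1$ with $$V\cap T^{-k}V\cap T^{-2k}V\cap\dots\cap T^{-dk}V\neq\emptyset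 .$$ (iii) $\Omega_0(X,T)=X$, $\Omega_{\beta+1}(X,T)=\Omega(\Omega_\beta(X,T),T)$, and $\Omega_\lambda(X,T)=\bigcap_{\beta<\lambda}\Omega_\beta(X,T)$ for limit ordinals $\lambda$; the sets $\Omega^{(\infty)}_\beta(X,T)$ are defined in the same way with $\Omega^{(\infty)}$ in place of $\Omega$. Then $$\mathrm{depth}(X,T)=\min\{\beta:\Omega_\beta(X,T)=\Omega_{\beta+1}(X,T)\},\qquad \mathrm{depth}^{(\infty)}(X,T)=\min\{\beta:\Omega^{(\infty)}_\beta(X,T)=\Omega^{(\infty)}_{\beta+1}(X,T)\}.$$ -/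

import Mathlib

/-- `X` has derived degree `α`: the derived set of order `α` of the whole space is nonempty and
the one of order `α + 1` is empty.  (The derived sets of order `0`, `β + 1`, and a limit `λ` are
`X`, the set of accumulation points of the derived set of order `β`, and the intersection of the
derived sets of smaller order.) -/
def HasDerivedDegree (X : Type*) [TopologicalSpace X] (α : Ordinal) : Prop :=
  (CantorBendixson.iteratedDerivedSet (Set.univ : Set X) α).Nonempty ∧
    CantorBendixson.iteratedDerivedSet (Set.univ : Set X) (α + 1) = ∅

/-- The non-wandering points of the subsystem `(A, T)`: the traces `U ∩ A` of neighbourhoods `U`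
in `X` of a point `x ∈ A` are the neighbourhoods of `x` in the subspace `A`. -/
def nonwanderingSet {X : Type*} [TopologicalSpace X] (T : X → X) (A : Set X) : Set X :=
  {x | x ∈ A ∧ ∀ U ∈ nhds x, ∃ n : ℕ, 0 < n ∧ ((U ∩ A) ∩ T^[n] ⁻¹' (U ∩ A)).Nonempty}

/-- The multi-non-wandering points of the subsystem `(A, T)`: every neighbourhood `V = U ∩ A` of
the point in `A` satisfies, for every `d ≥ 1`, that
`V ∩ T⁻ᵏ V ∩ T⁻²ᵏ V ∩ ⋯ ∩ T⁻ᵈᵏ V` is nonempty for some `k ≥ 1`. -/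
def multiNonwanderingSet {X : Type*} [TopologicalSpace X] (T : X → X) (A : Set X) : Set X :=
  {x | x ∈ A ∧ ∀ U ∈ nhds x, ∀ d : ℕ, 0 < d →
    ∃ k : ℕ, 0 < k ∧ (⋂ i ∈ Set.Iic d, T^[i * k] ⁻¹' (U ∩ A)).Nonempty}

/-- Transfinite iteration of an operator on subsets of `X`, starting from the whole space and
taking intersections at limit ordinals. -/
noncomputable def transfiniteIter {X : Type*} (F : Set X → Set X) (α : Ordinal) : Set X :=
  Ordinal.limitRecOn (motive := fun _ => Set X) α Set.univ (fun _ A => F A)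
    (fun o _ A => ⋂ (β : Ordinal) (h : β < o), A β h)

/-- The (Birkhoff) depth of `(X, T)` is `α`: it is the least ordinal at which the iterated
non-wandering sets become stationary. -/
def HasBirkhoffDepth {X : Type*} [TopologicalSpace X] (T : X → X) (α : Ordinal) : Prop :=
  IsLeast {β : Ordinal | transfiniteIter (nonwanderingSet T) β =
    transfiniteIter (nonwanderingSet T) (β + 1)} α

/-- The van der Waerden depth of `(X, T)` is `α`: it is the least ordinal at which the iterated
multi-non-wandering sets become stationary. -/
def HasVanDerWaerdenDepth {X : Type*} [TopologicalSpace X] (T : X → X) (α : Ordinal) : Prop :=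
  IsLeast {β : Ordinal | transfiniteIter (multiNonwanderingSet T) β =
    transfiniteIter (multiNonwanderingSet T) (β + 1)} α

/-! All three invariants can be read off one rank function on `X` (`IsRecurrenceRank`). A point is
isolated among points of at least its own rank, so it is lost from the derived set and, not being
periodic, from the nonwandering set too. A point of larger rank survives multiple recurrence. Hence
all three transfinite sequences are the superlevel sets of the rank up to `α`, where only fixed
points remain.

Such a system is a shift on labelled configurations. Let `ρ` take every value below `α` infinitely
often. A finite set `S` along which `ρ` decreases labels a translate of the finite set
`factorialSums S`; the rank is the least `ρ` on `S`, or `α` for the blank configuration. Adding a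
large label `j` replaces the pattern by distant copies spaced by `(j + 2)!`, with `j + 1` copies in
progression: this gives recurrence (`agreeOn_insert`). Conversely, a configuration close to one with
labels `S ≠ ∅` can only have extra labels beyond `S`, hence smaller rank
(`eventually_configRank_lt`). Well-foundedness of the ordinals keeps label sets finite in the limit,
so the space is compact (`isClosed_configSpace`). -/

open Set Filter Topology Function

/-! ### Depths and derived degree from a rank function -/

section RankFunction

theorem transfiniteIter_zero {X : Type*} (F : Set X → Set X) :
    transfiniteIter F 0 = Set.univ := by
  simp [transfiniteIter]

theorem transfiniteIter_add_one {X : Type*} (F : Set X → Set X) (α : Ordinal) :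
    transfiniteIter F (α + 1) = F (transfiniteIter F α) := by
  simp [transfiniteIter]

theorem transfiniteIter_limit {X : Type*} (F : Set X → Set X) {α : Ordinal}
    (h : Order.IsSuccLimit α) :
    transfiniteIter F α = ⋂ (β : Ordinal) (_ : β < α), transfiniteIter F β := by
  unfold transfiniteIter
  rw [Ordinal.limitRecOn_limit _ _ _ _ h]

theorem multiNonwanderingSet_subset_nonwanderingSet {X : Type*} [TopologicalSpace X] (T : X → X)
    (A : Set X) : multiNonwanderingSet T A ⊆ nonwanderingSet T A := by
  rintro x ⟨hx, h⟩
  refine ⟨hx, fun U hU => ?_⟩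
  obtain ⟨k, hk, y, hy⟩ := h U hU 1 one_pos
  simp only [mem_iInter, mem_Iic, mem_preimage] at hy
  exact ⟨k, hk, y, by simpa using hy 0 zero_le_one, by simpa using hy 1 le_rfl⟩

theorem transfiniteIter_eq_of_rank {X : Type*} {F : Set X → Set X} {r : X → Ordinal} {α : Ordinal}
    (hF : ∀ γ < α, F {x | γ ≤ r x} = {x | γ + 1 ≤ r x}) (γ : Ordinal) (hγ : γ ≤ α) :
    transfiniteIter F γ = {x | γ ≤ r x} := by
  induction γ using Ordinal.limitRecOn with
  | zero => simp [transfiniteIter_zero]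
  | add_one γ ih =>
    have h : γ < α := Order.add_one_le_iff.1 hγ
    rw [transfiniteIter_add_one, ih h.le, hF γ h]
  | limit γ hl ih =>
    rw [transfiniteIter_limit _ hl]
    ext x
    simp only [mem_iInter, mem_ofPred_eq]
    constructor
    · intro h
      refine (hl.le_iff_forall_le).2 fun β hβ => ?_
      have := h β hβ
      rwa [ih β hβ (hβ.le.trans hγ)] at this
    · intro h β hβ
      rw [ih β hβ (hβ.le.trans hγ)]
      exact hβ.le.trans h

theorem isLeast_transfiniteIter_of_rank {X : Type*} {F : Set X → Set X} {r : X → Ordinal}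
    {α : Ordinal} (hF : ∀ γ < α, F {x | γ ≤ r x} = {x | γ + 1 ≤ r x})
    (htop : F {x | α ≤ r x} = {x | α ≤ r x}) (hex : ∀ γ < α, ∃ x, r x = γ) :
    IsLeast {β : Ordinal | transfiniteIter F β = transfiniteIter F (β + 1)} α := by
  constructor
  · simp only [mem_ofPred_eq]
    rw [transfiniteIter_add_one, transfiniteIter_eq_of_rank hF α le_rfl, htop]
  · intro γ hγ
    by_contra! hlt
    simp only [mem_ofPred_eq] at hγ
    rw [transfiniteIter_eq_of_rank hF γ hlt.le,
      transfiniteIter_eq_of_rank hF (γ + 1) (Order.add_one_le_iff.2 hlt)] at hγ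
    obtain ⟨x, hx⟩ := hex γ hlt
    have : x ∈ {x | γ + 1 ≤ r x} := hγ ▸ hx.ge
    exact absurd (Order.add_one_le_iff.1 this) hx.not_gt

/-- A rank function for the map `T`: it has a strict local maximum at each point `x`, it is
unbounded below `r x` along arithmetic progressions of times returning to each
neighbourhood of `x`, and the points of maximal rank `α` are fixed while all others are not
periodic. -/
structure IsRecurrenceRank {X : Type*} [TopologicalSpace X] (T : X → X) (r : X → Ordinal)
    (α : Ordinal) : Prop where
  le_top : ∀ x, r x ≤ α
  exists_top : ∃ x, r x = α
  fixed_of_top : ∀ x, r x = α → T x = x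
  not_periodic : ∀ x, r x < α → ∀ n, 0 < n → T^[n] x ≠ x
  eventually_lt : ∀ x, ∀ᶠ y in 𝓝[≠] x, r y < r x
  exists_recurrent : ∀ x, ∀ γ < r x, ∀ U ∈ 𝓝 x, ∀ d : ℕ, ∃ k : ℕ, 0 < k ∧ ∃ y, y ≠ x ∧
    ∀ i ≤ d, T^[i * k] y ∈ U ∧ γ ≤ r (T^[i * k] y)

namespace IsRecurrenceRank

variable {X : Type*} [TopologicalSpace X] {T : X → X} {r : X → Ordinal} {α : Ordinal}

theorem exists_near (h : IsRecurrenceRank T r α) {x : X} {γ : Ordinal} (hγ : γ < r x) {U : Set X}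
    (hU : U ∈ 𝓝 x) : ∃ y ∈ U, y ≠ x ∧ γ ≤ r y := by
  obtain ⟨k, -, y, hyx, hy⟩ := h.exists_recurrent x γ hγ U hU 0
  have := hy 0 le_rfl
  simp only [zero_mul, iterate_zero, id_eq] at this
  exact ⟨y, this.1, hyx, this.2⟩

theorem exists_nhds_inter (h : IsRecurrenceRank T r α) (x : X) :
    ∃ U ∈ 𝓝 x, ∀ y ∈ U, r x ≤ r y → y = x := by
  refine ⟨_, eventually_nhdsWithin_iff.1 (h.eventually_lt x), fun y hy hxy => ?_⟩
  by_contra hne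
  exact absurd (hy hne) hxy.not_gt

theorem relDerivedSet_eq (h : IsRecurrenceRank T r α) (γ : Ordinal) :
    relDerivedSet {x | γ ≤ r x} = {x | γ + 1 ≤ r x} := by
  ext x
  simp only [relDerivedSet_apply, mem_inter_iff, mem_derivedSet, accPt_iff_nhds, mem_ofPred_eq,
    Order.add_one_le_iff]
  constructor
  · rintro ⟨hacc, hx⟩
    refine lt_of_le_of_ne hx ?_
    rintro rfl
    obtain ⟨U, hU, hUx⟩ := h.exists_nhds_inter x
    obtain ⟨y, hy, hne⟩ := hacc U hU
    exact hne (hUx y hy.1 hy.2)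
  · intro hx
    refine ⟨fun U hU => ?_, hx.le⟩
    obtain ⟨y, hyU, hne, hy⟩ := h.exists_near hx hU
    exact ⟨y, ⟨hyU, hy⟩, hne⟩

theorem iteratedDerivedSet_eq (h : IsRecurrenceRank T r α) (γ : Ordinal) :
    CantorBendixson.iteratedDerivedSet (Set.univ : Set X) γ = {x | γ ≤ r x} := by
  induction γ using Ordinal.limitRecOn with
  | zero => simp
  | add_one γ ih => rw [CantorBendixson.iteratedDerivedSet_succ, ih, h.relDerivedSet_eq]
  | limit γ hl ih =>
    rw [CantorBendixson.iteratedDerivedSet_limit hl]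
    ext x
    simp only [mem_iInter, mem_ofPred_eq, Subtype.forall, mem_Iio]
    rw [hl.le_iff_forall_le]
    refine forall₂_congr fun β hβ => ?_
    rw [ih β hβ, mem_ofPred_eq]

/-- A point of rank exactly `γ` is isolated in the superlevel set, so a return to a small
neighbourhood would make it periodic. -/
theorem nonwanderingSet_subset (h : IsRecurrenceRank T r α) {γ : Ordinal} (hγ : γ < α) :
    nonwanderingSet T {x | γ ≤ r x} ⊆ {x | γ + 1 ≤ r x} := by
  rintro x ⟨hx, hx'⟩
  refine Order.add_one_le_iff.2 (lt_of_le_of_ne (show γ ≤ r x from hx) ?_)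
  rintro rfl
  obtain ⟨U, hU, hUx⟩ := h.exists_nhds_inter x
  obtain ⟨n, hn, y, hy, hny⟩ := hx' U hU
  have h1 := hUx y hy.1 hy.2
  have h2 := hUx _ hny.1 hny.2
  exact h.not_periodic x hγ n hn (by rw [h1] at h2; exact h2)

theorem subset_multiNonwanderingSet (h : IsRecurrenceRank T r α) (γ : Ordinal) :
    {x | γ + 1 ≤ r x} ⊆ multiNonwanderingSet T {x | γ ≤ r x} := by
  intro x hx
  have hx : γ < r x := Order.add_one_le_iff.1 hx
  refine ⟨hx.le, fun U hU d _ => ?_⟩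
  obtain ⟨k, hk, y, -, hy⟩ := h.exists_recurrent x γ hx U hU d
  exact ⟨k, hk, y, mem_iInter₂.2 fun i hi => hy i hi⟩

theorem top_subset_multiNonwanderingSet (h : IsRecurrenceRank T r α) :
    {x | α ≤ r x} ⊆ multiNonwanderingSet T {x | α ≤ r x} := by
  intro x hx
  refine ⟨hx, fun U hU d _ => ⟨1, one_pos, x, ?_⟩⟩
  have hfix : IsFixedPt T x := h.fixed_of_top x (le_antisymm (h.le_top x) hx)
  simp only [mem_iInter, mem_preimage]
  intro i _
  rw [(hfix.iterate _).eq]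
  exact ⟨mem_of_mem_nhds hU, hx⟩

theorem exists_rank_eq (h : IsRecurrenceRank T r α) {γ : Ordinal} (hγ : γ < α) :
    ∃ x, r x = γ := by
  obtain ⟨x₀, hx₀⟩ := h.exists_top
  -- A point of least rank among those of rank at least `γ` has rank `γ`: otherwise a nearby point
  -- would have smaller rank, still at least `γ`.
  obtain ⟨x, hx, hmin⟩ := (InvImage.wf r (wellFounded_lt (α := Ordinal))).has_min {x | γ ≤ r x}
    ⟨x₀, hγ.le.trans hx₀.ge⟩
  refine ⟨x, (eq_of_le_of_not_lt hx fun hlt => ?_).symm⟩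
  obtain ⟨U, hU, hUx⟩ := h.exists_nhds_inter x
  obtain ⟨y, hyU, hne, hy⟩ := h.exists_near hlt hU
  exact hne (hUx y hyU (not_lt.1 (hmin y hy)))

theorem hasDerivedDegree (h : IsRecurrenceRank T r α) : HasDerivedDegree X α := by
  obtain ⟨x, hx⟩ := h.exists_top
  refine ⟨⟨x, ?_⟩, ?_⟩
  · rw [h.iteratedDerivedSet_eq]
    exact hx.ge
  · rw [h.iteratedDerivedSet_eq, eq_empty_iff_forall_notMem]
    exact fun y hy => absurd (Order.add_one_le_iff.1 hy) (h.le_top y).not_gt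

theorem hasBirkhoffDepth (h : IsRecurrenceRank T r α) : HasBirkhoffDepth T α :=
  isLeast_transfiniteIter_of_rank
    (fun γ hγ => (h.nonwanderingSet_subset hγ).antisymm <|
      (h.subset_multiNonwanderingSet γ).trans (multiNonwanderingSet_subset_nonwanderingSet _ _))
    (Subset.antisymm (fun _ hx => hx.1) <|
      h.top_subset_multiNonwanderingSet.trans (multiNonwanderingSet_subset_nonwanderingSet _ _))
    fun _ hγ => h.exists_rank_eq hγ

theorem hasVanDerWaerdenDepth (h : IsRecurrenceRank T r α) : HasVanDerWaerdenDepth T α :=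
  isLeast_transfiniteIter_of_rank
    (fun γ hγ => ((multiNonwanderingSet_subset_nonwanderingSet _ _).trans
      (h.nonwanderingSet_subset hγ)).antisymm (h.subset_multiNonwanderingSet γ))
    (Subset.antisymm (fun _ hx => hx.1) h.top_subset_multiNonwanderingSet)
    fun _ hγ => h.exists_rank_eq hγ

end IsRecurrenceRank

end RankFunction

/-! ### Sparse sums in the factorial number system -/

section FactorialSums

/-- The integers with digits in the places of `S` only, for the digit bounds `c j ≤ j` and the
place values `(j + 2)!`. -/
def factorialSums (S : Finset ℕ) : Set ℤ :=
  {p | ∃ c : ℕ → ℕ, (∀ j, c j ≤ j) ∧ p = ((∑ j ∈ S, c j * (j + 2).factorial : ℕ) : ℤ)}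

theorem zero_mem_factorialSums (S : Finset ℕ) : (0 : ℤ) ∈ factorialSums S :=
  ⟨fun _ => 0, fun _ => Nat.zero_le _, by simp⟩

theorem nonneg_of_mem_factorialSums {S : Finset ℕ} {p : ℤ} (hp : p ∈ factorialSums S) : 0 ≤ p := by
  obtain ⟨c, -, rfl⟩ := hp
  positivity

theorem sum_range_mul_factorial_lt (n : ℕ) :
    ∑ j ∈ Finset.range n, j * (j + 2).factorial + 2 * n < (n + 2).factorial := by
  induction n with
  | zero => simp [Nat.factorial]
  | succ n ih =>
    rw [Finset.sum_range_succ, show n + 1 + 2 = (n + 2) + 1 by ring, Nat.factorial_succ (n + 2)]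
    have : 2 ≤ (n + 2).factorial := by
      calc 2 = (0 + 2).factorial := rfl
        _ ≤ _ := Nat.factorial_le (by omega)
    nlinarith

theorem add_lt_factorial_of_mem_factorialSums {S : Finset ℕ} {n : ℕ} (hS : ∀ j ∈ S, j < n) {p : ℤ}
    (hp : p ∈ factorialSums S) : p + 2 * n < ((n + 2).factorial : ℤ) := by
  obtain ⟨c, hc, rfl⟩ := hp
  have h1 : ∑ j ∈ S, c j * (j + 2).factorial ≤ ∑ j ∈ Finset.range n, j * (j + 2).factorial :=
    (Finset.sum_le_sum fun j _ => Nat.mul_le_mul_right _ (hc j)).trans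
      (Finset.sum_le_sum_of_subset fun j hj => Finset.mem_range.2 (hS j hj))
  have h2 := sum_range_mul_factorial_lt n
  exact_mod_cast (by omega : ∑ j ∈ S, c j * (j + 2).factorial + 2 * n < (n + 2).factorial)

theorem finite_factorialSums (S : Finset ℕ) : (factorialSums S).Finite := by
  obtain ⟨n, hn⟩ : ∃ n, ∀ j ∈ S, j < n := ⟨S.sup id + 1, fun j hj =>
    Nat.lt_succ_of_le (Finset.le_sup (f := id) hj)⟩
  refine (Set.finite_Icc (0 : ℤ) (n + 2).factorial).subset fun p hp => ?_
  have := add_lt_factorial_of_mem_factorialSums hn hp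
  exact ⟨nonneg_of_mem_factorialSums hp, by omega⟩

theorem mem_factorialSums_union {S R : Finset ℕ} (h : Disjoint S R) {p : ℤ} :
    p ∈ factorialSums (S ∪ R) ↔ ∃ b ∈ factorialSums R, p - b ∈ factorialSums S := by
  classical
  constructor
  · rintro ⟨c, hc, rfl⟩
    refine ⟨_, ⟨c, hc, rfl⟩, c, hc, ?_⟩
    rw [Finset.sum_union h]
    push_cast
    ring
  · rintro ⟨b, ⟨c, hc, rfl⟩, c', hc', h'⟩
    refine ⟨fun j => if j ∈ S then c' j else c j,
      fun j => by dsimp only; split_ifs <;> simp [hc, hc'], ?_⟩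
    rw [Finset.sum_union h, Finset.sum_congr rfl (g := fun j => c' j * (j + 2).factorial)
      (fun j hj => by simp [hj]),
      Finset.sum_congr (s₁ := R) rfl (g := fun j => c j * (j + 2).factorial)
      (fun j hj => by simp [Finset.disjoint_right.1 h hj])]
    push_cast at h' ⊢
    linarith

theorem dvd_of_mem_factorialSums {S : Finset ℕ} {n : ℕ} (hS : ∀ j ∈ S, n ≤ j) {p : ℤ}
    (hp : p ∈ factorialSums S) : ((n + 2).factorial : ℤ) ∣ p := by
  obtain ⟨c, -, rfl⟩ := hp
  exact Int.natCast_dvd_natCast.2 <| Finset.dvd_sum fun j hj =>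
    Dvd.dvd.mul_left (Nat.factorial_dvd_factorial (by have := hS j hj; omega)) _

/-- In a window of length `2 n`, the set `factorialSums` of `S ∪ R` looks like one translate of
the one of `S`, if `n` separates `S` from `R`. -/
theorem eq_of_mem_factorialSums_window {S R : Finset ℕ} {n : ℕ} (hS : ∀ j ∈ S, j < n)
    (hR : ∀ j ∈ R, n ≤ j) {b b' p p' : ℤ} (hb : b ∈ factorialSums R) (hb' : b' ∈ factorialSums R)
    (hp : p - b ∈ factorialSums S) (hp' : p' - b' ∈ factorialSums S) (hpp' : (p - p').natAbs ≤ 2 * n) :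
    b = b' := by
  have h1 := dvd_sub (dvd_of_mem_factorialSums hR hb) (dvd_of_mem_factorialSums hR hb')
  have h2 := add_lt_factorial_of_mem_factorialSums hS hp
  have h3 := add_lt_factorial_of_mem_factorialSums hS hp'
  have h4 := nonneg_of_mem_factorialSums hp
  have h5 := nonneg_of_mem_factorialSums hp'
  -- The high parts differ by a multiple of `(n + 2)!`, yet by at most `2 * n` plus the difference
  -- of the low parts, which is less than `(n + 2)! - 2 * n`.
  have := Int.eq_zero_of_abs_lt_dvd h1 (abs_lt.2 ⟨by omega, by omega⟩)
  omega

theorem not_add_invariant_factorialSums (S : Finset ℕ) {n : ℤ} (hn : 0 < n) :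
    ¬ ∀ p, p + n ∈ factorialSums S ↔ p ∈ factorialSums S := by
  intro h
  have := nonneg_of_mem_factorialSums ((h (-n)).1 (by simpa using zero_mem_factorialSums S))
  omega

end FactorialSums

/-! ### The shift on labelled configurations -/

section LabelledConfigurations

open Classical in
/-- The configuration on `ℤ` with label `S` at the translate by `-m` of `factorialSums S` and label
`∅` elsewhere. -/
noncomputable def labelledConfig (S : Finset ℕ) (m : ℤ) : ℤ × ℕ → Bool :=
  fun q => decide (q.2 ∈ S ∧ q.1 + m ∈ factorialSums S)

theorem labelledConfig_apply {S : Finset ℕ} {m p : ℤ} {j : ℕ} :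
    labelledConfig S m (p, j) = true ↔ j ∈ S ∧ p + m ∈ factorialSums S := by
  simp [labelledConfig]

theorem labelledConfig_empty (m : ℤ) : labelledConfig ∅ m = fun _ => false := by
  funext q
  simp [labelledConfig]

/-- The finite sets of naturals along which `ρ` is strictly decreasing below `α`. -/
def IsDescending (ρ : ℕ → Ordinal.{0}) (α : Ordinal.{0}) (S : Finset ℕ) : Prop :=
  (∀ j ∈ S, ρ j < α) ∧ ∀ i ∈ S, ∀ j ∈ S, i < j → ρ j < ρ i

theorem IsDescending.mono {ρ : ℕ → Ordinal.{0}} {α : Ordinal.{0}} {S R : Finset ℕ}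
    (h : IsDescending ρ α S) (hRS : R ⊆ S) : IsDescending ρ α R :=
  ⟨fun j hj => h.1 j (hRS hj), fun i hi j hj => h.2 i (hRS hi) j (hRS hj)⟩

/-- The space of all labelled configurations along descending sets. -/
def configSpace (ρ : ℕ → Ordinal.{0}) (α : Ordinal.{0}) : Set (ℤ × ℕ → Bool) :=
  {z | ∃ S m, IsDescending ρ α S ∧ z = labelledConfig S m}

theorem labelledConfig_mem_configSpace {ρ : ℕ → Ordinal.{0}} {α : Ordinal.{0}} {S : Finset ℕ}
    (h : IsDescending ρ α S) (m : ℤ) : labelledConfig S m ∈ configSpace ρ α :=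
  ⟨S, m, h, rfl⟩

theorem countable_configSpace (ρ : ℕ → Ordinal.{0}) (α : Ordinal.{0}) :
    (configSpace ρ α).Countable := by
  refine (Set.countable_range fun q : Finset ℕ × ℤ => labelledConfig q.1 q.2).mono ?_
  rintro _ ⟨S, m, -, rfl⟩
  exact ⟨(S, m), rfl⟩

/-- Agreement of two configurations at the positions `p` with `|p| ≤ n` and labels below `n`. -/
def AgreeOn (n : ℕ) (z w : ℤ × ℕ → Bool) : Prop :=
  ∀ p : ℤ, p.natAbs ≤ n → ∀ j < n, z (p, j) = w (p, j)

theorem agreeOn_mem_nhds (n : ℕ) (z : ℤ × ℕ → Bool) : {w | AgreeOn n w z} ∈ 𝓝 z := by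
  have hfin : (Set.Icc (-(n : ℤ)) n ×ˢ Set.Iio n).Finite :=
    (Set.finite_Icc _ _).prod (Set.finite_Iio _)
  have : ∀ᶠ w in 𝓝 z, ∀ q ∈ Set.Icc (-(n : ℤ)) n ×ˢ Set.Iio n, w q = z q := by
    rw [Filter.eventually_all_finite hfin]
    intro q _
    exact (continuous_apply (A := fun _ : ℤ × ℕ => Bool) q).continuousAt.preimage_mem_nhds
      ((isOpen_discrete {z q}).mem_nhds rfl)
  filter_upwards [this] with w hw p hp j hj
  exact hw (p, j) ⟨⟨by omega, by omega⟩, hj⟩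

theorem exists_agreeOn_subset {z : ℤ × ℕ → Bool} {U : Set (ℤ × ℕ → Bool)} (hU : U ∈ 𝓝 z) :
    ∃ n, {w | AgreeOn n w z} ⊆ U := by
  rw [nhds_pi, Filter.mem_pi] at hU
  obtain ⟨I, hI, t, ht, hsub⟩ := hU
  obtain ⟨n, hn⟩ : ∃ n : ℕ, ∀ q ∈ I, q.1.natAbs ≤ n ∧ q.2 < n := by
    refine ⟨hI.toFinset.sup (fun q => q.1.natAbs + q.2 + 1), fun q hq => ?_⟩
    have := Finset.le_sup (f := fun q : ℤ × ℕ => q.1.natAbs + q.2 + 1) (hI.mem_toFinset.2 hq)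
    constructor <;> omega
  refine ⟨n, fun w hw => hsub fun q hq => ?_⟩
  rw [hw q.1 (hn q hq).1 q.2 (hn q hq).2]
  exact mem_of_mem_nhds (ht q)

/-- A window of radius `n` meets at most one block of low-place sums, since all its occupied
positions share their digits in the places from `n` on. -/
theorem exists_agreeOn_filter (S : Finset ℕ) (m : ℤ) (n : ℕ) :
    AgreeOn n (labelledConfig S m) (fun _ => false) ∨
      ∃ m', AgreeOn n (labelledConfig S m) (labelledConfig (S.filter (· < n)) m') := by
  by_contra! hcon
  obtain ⟨h0, h⟩ := hcon
  simp only [AgreeOn, not_forall] at h0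
  obtain ⟨p, hp, j, hj, hpj⟩ := h0
  rw [Bool.not_eq_false, labelledConfig_apply] at hpj
  have hS : S = S.filter (· < n) ∪ S.filter (¬ · < n) :=
    (Finset.filter_union_filter_not_eq _ _).symm
  have hd : Disjoint (S.filter (· < n)) (S.filter (¬ · < n)) :=
    Finset.disjoint_filter_filter_not _ _ _
  have hlt : ∀ j ∈ S.filter (· < n), j < n := fun j hj => (Finset.mem_filter.1 hj).2
  have hge : ∀ j ∈ S.filter (¬ · < n), n ≤ j := fun j hj => not_lt.1 (Finset.mem_filter.1 hj).2
  have key : ∀ q : ℤ, q ∈ factorialSums S ↔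
      ∃ b ∈ factorialSums (S.filter (¬ · < n)), q - b ∈ factorialSums (S.filter (· < n)) := by
    intro q
    rw [← mem_factorialSums_union hd, ← hS]
  obtain ⟨b, hb, hpb⟩ := (key _).1 hpj.2
  refine h (m - b) fun p' hp' j' hj' => ?_
  rw [Bool.eq_iff_iff, labelledConfig_apply, labelledConfig_apply, Finset.mem_filter, key]
  refine and_congr (by simp [hj']) ⟨?_, fun h' => ⟨b, hb, by rwa [add_sub_assoc]⟩⟩
  rintro ⟨b', hb', hpb'⟩
  have := eq_of_mem_factorialSums_window hlt hge hb hb' hpb hpb' (by omega)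
  rwa [this, ← add_sub_assoc]

/-- The shift by `i * (j + 2)!` brings into view the copy of the pattern whose digit in place `j` is
`i`; this digit is allowed because `i ≤ j`. -/
theorem agreeOn_insert {S : Finset ℕ} {m : ℤ} {n j i : ℕ} (hS : ∀ s ∈ S, s < j) (hn : n + m.natAbs ≤ j)
    (hij : i ≤ j) :
    AgreeOn n (labelledConfig (insert j S) (m + (i * (j + 2).factorial : ℕ)))
      (labelledConfig S m) := by
  intro p hp s hs
  rw [Bool.eq_iff_iff, labelledConfig_apply, labelledConfig_apply]
  have hd : Disjoint S {j} := Finset.disjoint_singleton_right.2 fun h => (hS j h).false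
  have hsj : s ≠ j := by omega
  have hi : ((i * (j + 2).factorial : ℕ) : ℤ) ∈ factorialSums {j} :=
    ⟨fun s => if s = j then i else 0, fun s => by dsimp only; split_ifs <;> omega, by simp⟩
  rw [Finset.mem_insert, or_iff_right hsj, Finset.insert_eq, Finset.union_comm,
    mem_factorialSums_union hd]
  refine and_congr_right fun _ => ⟨?_, fun h => ⟨_, hi, by convert h using 1; ring⟩⟩
  rintro ⟨b, hb, hpb⟩
  have hwin : (p + (m + ((i * (j + 2).factorial : ℕ) : ℤ)) -
      ((i * (j + 2).factorial : ℕ) : ℤ)).natAbs ≤ 2 * j := by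
    omega
  have := eq_of_mem_factorialSums_window (S := S) (R := {j}) hS (by simp) hb hi hpb
    (p' := ((i * (j + 2).factorial : ℕ) : ℤ)) (by simpa using zero_mem_factorialSums S) hwin
  rw [this] at hpb
  convert hpb using 1
  ring

theorem isClosed_configSpace (ρ : ℕ → Ordinal.{0}) (α : Ordinal.{0}) :
    IsClosed (configSpace ρ α) := by
  classical
  refine isClosed_of_closure_subset fun z hz => ?_
  have approx : ∀ n : ℕ, ∃ S m, IsDescending ρ α S ∧ (∀ s ∈ S, s < n) ∧
      AgreeOn n z (labelledConfig S m) := by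
    intro n
    obtain ⟨_, hw, S, m, hS, rfl⟩ := mem_closure_iff_nhds.1 hz _ (agreeOn_mem_nhds n z)
    rcases exists_agreeOn_filter S m n with h | ⟨m', h⟩
    · refine ⟨∅, 0, hS.mono (by simp), by simp, ?_⟩
      rw [labelledConfig_empty]
      exact fun p hp j hj => (hw p hp j hj).symm.trans (h p hp j hj)
    · exact ⟨_, m', hS.mono (Finset.filter_subset _ _), fun s hs => (Finset.mem_filter.1 hs).2,
        fun p hp j hj => (hw p hp j hj).symm.trans (h p hp j hj)⟩
  -- An occupied position `p₀` of the limit carries all labels of every sufficiently good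
  -- approximant, so the limit's labels can be read there.
  by_cases hz0 : ∃ p₀ j₀, z (p₀, j₀) = true
  · obtain ⟨p₀, j₀, h₀⟩ := hz0
    choose S m hS hlt hag using approx
    have hN : ∀ n, p₀.natAbs + j₀ + 1 ≤ n → p₀ + m n ∈ factorialSums (S n) ∧
        ∀ j < n, z (p₀, j) = true ↔ j ∈ S n := by
      intro n hn
      have h1 : p₀ + m n ∈ factorialSums (S n) := by
        have := hag n p₀ (by omega) j₀ (by omega)
        rw [h₀] at this
        exact (labelledConfig_apply.1 this.symm).2
      refine ⟨h1, fun j hj => ?_⟩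
      rw [hag n p₀ (by omega) j hj, labelledConfig_apply, and_iff_left h1]
    have hlab : ∀ i j, z (p₀, i) = true → z (p₀, j) = true → i < j → ρ j < ρ i := by
      intro i j hi hj hij
      have h := (hN (p₀.natAbs + j₀ + 1 + i + j) (by omega)).2
      exact (hS _).2 i ((h i (by omega)).1 hi) j ((h j (by omega)).1 hj) hij
    -- Infinitely many labels would give an infinite descending sequence of ordinals.
    have hfin : {j | z (p₀, j) = true}.Finite := by
      by_contra hinf
      have hinf : {j | z (p₀, j) = true}.Infinite := hinf
      let f := Nat.nth (fun j => z (p₀, j) = true)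
      obtain ⟨k, hk⟩ := WellFounded.not_rel_apply_succ (r := (· < ·)) (fun k => ρ (f k))
      exact hk (hlab _ _ (Nat.nth_mem_of_infinite hinf _) (Nat.nth_mem_of_infinite hinf _)
        (Nat.nth_strictMono hinf (Nat.lt_succ_self k)))
    set S₀ : Finset ℕ := hfin.toFinset with hS₀
    have hmem : ∀ j, j ∈ S₀ ↔ z (p₀, j) = true := fun j => by simp [hS₀]
    set N := p₀.natAbs + j₀ + 1 + S₀.sup id + 1 with hNdef
    have hSn : ∀ n, N ≤ n → S n = S₀ := by
      intro n hn
      ext j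
      rw [hmem]
      constructor
      · intro hj
        exact ((hN n (by omega)).2 j (hlt n j hj)).2 hj
      · intro hj
        have : j ≤ S₀.sup id := Finset.le_sup (f := id) ((hmem j).2 hj)
        exact ((hN n (by omega)).2 j (by omega)).1 hj
    have hmaps : ∀ n, p₀ + m (N + n) ∈ factorialSums S₀ := fun n => by
      have := (hN (N + n) (by omega)).1
      rwa [hSn _ (by omega)] at this
    -- The label sets have stabilised, and `p₀` corresponds to one of finitely many elements of
    -- `factorialSums S₀`, so some translate recurs infinitely often.
    obtain ⟨q, -, hq⟩ : ∃ q ∈ factorialSums S₀,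
        ((fun n => p₀ + m (N + n)) ⁻¹' {q}).Infinite := by
      by_contra! hcon
      refine Set.infinite_univ (α := ℕ) (((finite_factorialSums S₀).biUnion hcon).subset ?_)
      intro n _
      simp only [mem_iUnion]
      exact ⟨_, hmaps n, rfl⟩
    refine ⟨S₀, q - p₀, hSn N le_rfl ▸ hS N, ?_⟩
    funext ⟨p, j⟩
    obtain ⟨n, hn, hnlarge⟩ := hq.exists_gt (p.natAbs + j)
    have hn : p₀ + m (N + n) = q := hn
    rw [hag (N + n) p (by omega) j (by omega), hSn _ (by omega)]
    congr 1
    omega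
  · refine ⟨∅, 0, ⟨by simp, by simp⟩, ?_⟩
    rw [labelledConfig_empty]
    push Not at hz0
    funext ⟨p, j⟩
    simpa using hz0 p j

/-- The shift of configurations, as a homeomorphism. -/
def shiftHomeomorph : (ℤ × ℕ → Bool) ≃ₜ (ℤ × ℕ → Bool) :=
  Homeomorph.piCongrLeft (Y := fun _ : ℤ × ℕ => Bool)
    ((Equiv.addRight (-1 : ℤ)).prodCongr (Equiv.refl ℕ))

theorem shiftHomeomorph_apply (z : ℤ × ℕ → Bool) (p : ℤ) (j : ℕ) :
    shiftHomeomorph z (p, j) = z (p + 1, j) := by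
  have := Equiv.piCongrLeft_apply_apply (fun _ : ℤ × ℕ => Bool)
    ((Equiv.addRight (-1 : ℤ)).prodCongr (Equiv.refl ℕ)) z (p + 1, j)
  rw [show ((Equiv.addRight (-1 : ℤ)).prodCongr (Equiv.refl ℕ)) (p + 1, j) = (p, j) by simp] at this
  exact this

theorem shiftHomeomorph_labelledConfig (S : Finset ℕ) (m : ℤ) :
    shiftHomeomorph (labelledConfig S m) = labelledConfig S (m + 1) := by
  funext ⟨p, j⟩
  rw [shiftHomeomorph_apply, Bool.eq_iff_iff, labelledConfig_apply, labelledConfig_apply,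
    add_assoc, add_comm 1 m]

theorem shiftHomeomorph_mem_configSpace_iff (ρ : ℕ → Ordinal.{0}) (α : Ordinal.{0})
    (z : ℤ × ℕ → Bool) : z ∈ configSpace ρ α ↔ shiftHomeomorph z ∈ configSpace ρ α := by
  constructor
  · rintro ⟨S, m, hS, rfl⟩
    exact ⟨S, m + 1, hS, shiftHomeomorph_labelledConfig S m⟩
  · rintro ⟨S, m, hS, h⟩
    refine ⟨S, m - 1, hS, shiftHomeomorph.injective ?_⟩
    rw [h, shiftHomeomorph_labelledConfig, sub_add_cancel]

/-- The shift on the space of labelled configurations. -/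
def configShift (ρ : ℕ → Ordinal.{0}) (α : Ordinal.{0}) :
    configSpace ρ α ≃ₜ configSpace ρ α :=
  shiftHomeomorph.subtype (shiftHomeomorph_mem_configSpace_iff ρ α)

theorem coe_iterate_configShift {ρ : ℕ → Ordinal.{0}} {α : Ordinal.{0}} {S : Finset ℕ} {m : ℤ}
    {x : configSpace ρ α} (hx : x.1 = labelledConfig S m) (n : ℕ) :
    ((configShift ρ α)^[n] x).1 = labelledConfig S (m + n) := by
  induction n with
  | zero => simpa using hx
  | succ n ih =>
    rw [iterate_succ_apply']
    change shiftHomeomorph ((configShift ρ α)^[n] x).1 = _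
    rw [ih, shiftHomeomorph_labelledConfig]
    push_cast
    rw [add_assoc]

/-- The rank of a configuration: the least value of `ρ` at its labels, or `α` if there are none. -/
noncomputable def configRank (ρ : ℕ → Ordinal.{0}) (α : Ordinal.{0}) (z : ℤ × ℕ → Bool) :
    Ordinal.{0} :=
  sInf (insert α (ρ '' {j | ∃ p, z (p, j) = true}))

theorem lt_configRank_labelledConfig {ρ : ℕ → Ordinal.{0}} {α γ : Ordinal.{0}} {S : Finset ℕ}
    {m : ℤ} : γ < configRank ρ α (labelledConfig S m) ↔ γ < α ∧ ∀ j ∈ S, γ < ρ j := by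
  have hlab : {j | ∃ p, labelledConfig S m (p, j) = true} = S := by
    ext j
    simp only [labelledConfig_apply, mem_ofPred_eq, SetLike.mem_coe]
    exact ⟨fun ⟨_, h⟩ => h.1, fun h => ⟨-m, h, by simpa using zero_mem_factorialSums S⟩⟩
  rw [configRank, hlab]
  have hne : (insert α (ρ '' (S : Set ℕ))).Nonempty := ⟨α, mem_insert _ _⟩
  constructor
  · intro h
    exact ⟨h.trans_le (csInf_le' (mem_insert _ _)), fun j hj =>
      h.trans_le (csInf_le' (mem_insert_of_mem _ ⟨j, hj, rfl⟩))⟩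
  · rintro ⟨h1, h2⟩
    rcases csInf_mem hne with h | ⟨j, hj, h⟩
    · rwa [h]
    · rw [← h]
      exact h2 j hj

theorem configRank_labelledConfig_le {ρ : ℕ → Ordinal.{0}} {α : Ordinal.{0}} {S : Finset ℕ}
    {m : ℤ} : configRank ρ α (labelledConfig S m) ≤ α :=
  csInf_le' (mem_insert _ _)

theorem configRank_labelledConfig_lt_iff {ρ : ℕ → Ordinal.{0}} {α : Ordinal.{0}} {S : Finset ℕ}
    (hS : IsDescending ρ α S) {m : ℤ} :
    configRank ρ α (labelledConfig S m) < α ↔ S.Nonempty := by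
  constructor
  · intro h
    by_contra hne
    rw [Finset.not_nonempty_iff_eq_empty] at hne
    subst hne
    exact lt_irrefl _ (lt_configRank_labelledConfig.2 ⟨h, by simp⟩)
  · rintro ⟨j, hj⟩
    by_contra! h
    have := lt_configRank_labelledConfig.1 ((hS.1 j hj).trans_le h)
    exact lt_irrefl _ (this.2 j hj)

theorem eventually_configRank_lt {ρ : ℕ → Ordinal.{0}} {α : Ordinal.{0}} {S : Finset ℕ}
    (hS : IsDescending ρ α S) (m : ℤ) : ∀ᶠ w in 𝓝 (labelledConfig S m), w ∈ configSpace ρ α →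
      w ≠ labelledConfig S m → configRank ρ α w < configRank ρ α (labelledConfig S m) := by
  rcases S.eq_empty_or_nonempty with rfl | hne
  · refine Eventually.of_forall ?_
    rintro _ ⟨R, k, hR, rfl⟩ hw
    refine lt_of_lt_of_le ((configRank_labelledConfig_lt_iff hR).2 ?_)
      (not_lt.1 fun h => Finset.not_nonempty_empty ((configRank_labelledConfig_lt_iff hS).1 h))
    by_contra hne
    rw [Finset.not_nonempty_iff_eq_empty] at hne
    subst hne
    exact hw (by rw [labelledConfig_empty, labelledConfig_empty])
  · obtain ⟨s, hs⟩ := hne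
    -- The window contains the occupied position `-m` and all labels of `S`.
    set n := m.natAbs + S.sup id + 1 with hn
    have hSn : ∀ j ∈ S, j < n := fun j hj => by
      have : j ≤ S.sup id := Finset.le_sup (f := id) hj
      omega
    -- Configurations with the same labels `S` that occupy `-m` are finitely many, so a smaller
    -- neighbourhood avoids those other than the centre.
    have hfin : (labelledConfig S '' ((· + m) '' factorialSums S)).Finite :=
      ((finite_factorialSums S).image _).image _
    have h1 := (hfin.subset (Set.sdiff_subset (t := {labelledConfig S m}))).isClosed.isOpen_compl.mem_nhds
      (x := labelledConfig S m) (by simp)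
    filter_upwards [agreeOn_mem_nhds n (labelledConfig S m), h1] with w hw hw'
    rintro ⟨R, k, hR, rfl⟩ hne
    have hpos : -m + m ∈ factorialSums S := by simpa using zero_mem_factorialSums S
    have hk : -m + k ∈ factorialSums R := by
      have := hw (-m) (by omega) s (hSn s hs)
      rw [labelledConfig_apply.2 ⟨hs, hpos⟩] at this
      exact (labelledConfig_apply.1 this).2
    have hlab : ∀ j < n, j ∈ R ↔ j ∈ S := by
      intro j hj
      have := hw (-m) (by omega) j hj
      rw [Bool.eq_iff_iff, labelledConfig_apply, labelledConfig_apply, and_iff_left hk,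
        and_iff_left hpos] at this
      exact this
    have hSR : S ⊆ R := fun j hj => (hlab j (hSn j hj)).2 hj
    by_cases hRS : R ⊆ S
    · have hRS : R = S := hRS.antisymm hSR
      subst hRS
      exact absurd ⟨⟨k, ⟨-m + k, hk, by ring⟩, rfl⟩, hne⟩ hw'
    · obtain ⟨j, hjR, hjS⟩ := Finset.not_subset.1 hRS
      have hjn : n ≤ j := not_lt.1 fun h => hjS ((hlab j h).1 hjR)
      refine lt_of_le_of_lt (b := ρ j) (not_lt.1 fun h =>
        ((lt_configRank_labelledConfig.1 h).2 j hjR).false) ?_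
      exact lt_configRank_labelledConfig.2 ⟨hR.1 j hjR, fun i hi =>
        hR.2 i (hSR hi) j hjR ((hSn i hi).trans_le hjn)⟩

theorem exists_eq_labelledConfig {ρ : ℕ → Ordinal.{0}} {α : Ordinal.{0}} (x : configSpace ρ α) :
    ∃ (S : Finset ℕ) (m : ℤ) (hS : IsDescending ρ α S),
      x = ⟨labelledConfig S m, labelledConfig_mem_configSpace hS m⟩ := by
  obtain ⟨S, m, hS, h⟩ := x.2
  exact ⟨S, m, hS, Subtype.ext h⟩

theorem isRecurrenceRank_configRank {ρ : ℕ → Ordinal.{0}} {α : Ordinal.{0}}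
    (hρ : ∀ γ < α, ∀ N, ∃ j, N ≤ j ∧ ρ j = γ) :
    IsRecurrenceRank (configShift ρ α) (fun x => configRank ρ α x.1) α where
  le_top := by
    intro x
    obtain ⟨S, m, hS, rfl⟩ := exists_eq_labelledConfig x
    exact configRank_labelledConfig_le
  exists_top := by
    have h : IsDescending ρ α ∅ := ⟨by simp, by simp⟩
    refine ⟨⟨labelledConfig ∅ 0, labelledConfig_mem_configSpace h 0⟩, ?_⟩
    change configRank ρ α (labelledConfig ∅ 0) = α
    exact le_antisymm configRank_labelledConfig_le <| not_lt.1 fun h' =>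
      Finset.not_nonempty_empty ((configRank_labelledConfig_lt_iff h).1 h')
  fixed_of_top := by
    intro x h
    obtain ⟨S, m, hS, rfl⟩ := exists_eq_labelledConfig x
    have hS' : S = ∅ := Finset.not_nonempty_iff_eq_empty.1 fun h' =>
      h.not_lt ((configRank_labelledConfig_lt_iff hS).2 h')
    subst hS'
    refine Subtype.ext ((coe_iterate_configShift (S := ∅) (m := m) rfl 1).trans ?_)
    exact (labelledConfig_empty _).trans (labelledConfig_empty m).symm
  not_periodic := by
    intro x h n hn hper
    obtain ⟨S, m, hS, rfl⟩ := exists_eq_labelledConfig x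
    obtain ⟨s, hs⟩ := (configRank_labelledConfig_lt_iff hS).1 h
    have hper := (coe_iterate_configShift (S := S) (m := m) rfl n).symm.trans (congrArg Subtype.val hper)
    refine not_add_invariant_factorialSums S (n := n) (by exact_mod_cast hn) fun p => ?_
    have := congrFun hper (p - m, s)
    rw [Bool.eq_iff_iff, labelledConfig_apply, labelledConfig_apply, and_iff_right hs,
      and_iff_right hs] at this
    convert this using 2 <;> ring
  eventually_lt := by
    intro x
    obtain ⟨S, m, hS, rfl⟩ := exists_eq_labelledConfig x
    rw [eventually_nhdsWithin_iff, nhds_subtype_eq_comap]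
    filter_upwards [(eventually_configRank_lt hS m).comap Subtype.val] with y hy hne
    exact hy y.2 fun h => hne (Subtype.ext h)
  exists_recurrent := by
    intro x γ hγ U hU d
    obtain ⟨S, m, hS, rfl⟩ := exists_eq_labelledConfig x
    rw [nhds_subtype_eq_comap] at hU
    obtain ⟨V, hV, hVU⟩ := hU
    obtain ⟨n, hn⟩ := exists_agreeOn_subset hV
    obtain ⟨hγα, hγS⟩ := lt_configRank_labelledConfig.1 hγ
    -- The label `j` lies beyond `S`, is large enough for agreement on the window, and admits all
    -- digits up to `d`.
    obtain ⟨j, hj, rfl⟩ := hρ γ hγα (n + m.natAbs + d + S.sup id + 1)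
    have hSj : ∀ s ∈ S, s < j := fun s hs => by
      have : s ≤ S.sup id := Finset.le_sup (f := id) hs
      omega
    have hdesc : IsDescending ρ α (insert j S) := by
      refine ⟨(Finset.forall_mem_insert _ _ _).2 ⟨hγα, hS.1⟩, fun s hs t ht hst => ?_⟩
      rcases Finset.mem_insert.1 hs with rfl | hs' <;> rcases Finset.mem_insert.1 ht with rfl | ht'
      · exact absurd hst (lt_irrefl _)
      · exact absurd hst (hSj t ht').not_gt
      · exact hγS s hs'
      · exact hS.2 s hs' t ht' hst
    refine ⟨(j + 2).factorial, Nat.factorial_pos _,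
      ⟨labelledConfig (insert j S) m, labelledConfig_mem_configSpace hdesc m⟩, fun h => ?_, fun i hi => ⟨hVU (hn ?_), ?_⟩⟩
    · have := congrFun (congrArg Subtype.val h) (-m, j)
      rw [Bool.eq_iff_iff, labelledConfig_apply, labelledConfig_apply] at this
      exact (hSj j (this.1 ⟨Finset.mem_insert_self _ _, by
        simpa using zero_mem_factorialSums _⟩).1).false
    · rw [mem_ofPred_eq, coe_iterate_configShift (S := insert j S) (m := m) rfl]
      exact agreeOn_insert hSj (by omega) (by omega)
    · rw [coe_iterate_configShift (S := insert j S) (m := m) rfl]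
      refine not_lt.1 fun h => ?_
      -- A rank below `ρ j` would require a label of smaller value, but `ρ j` is the minimum over
      -- `insert j S`.
      obtain ⟨t, ht, htj⟩ : ∃ t ∈ insert j S, ρ t < ρ j := by
        by_contra! hcon
        refine h.not_ge (le_of_forall_lt fun δ hδ => lt_configRank_labelledConfig.2
          ⟨hδ.trans hγα, fun t ht => hδ.trans_le (hcon t ht)⟩)
      rcases Finset.mem_insert.1 ht with rfl | ht
      · exact htj.false
      · exact (htj.trans (hγS t ht)).false

end LabelledConfigurations

/-! ### Enumeration of a countable ordinal and conclusion -/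

theorem exists_frequently_enumeration {α : Ordinal.{0}} (hα : α < Ordinal.omega 1) :
    ∃ ρ : ℕ → Ordinal.{0}, ∀ γ < α, ∀ N, ∃ j, N ≤ j ∧ ρ j = γ := by
  have hc : (Set.Iio α).Countable := by
    have h := Cardinal.lt_omega_iff_card_lt.1 hα
    rw [← Cardinal.succ_aleph0, Order.lt_succ_iff] at h
    rw [← Cardinal.le_aleph0_iff_set_countable, Cardinal.mk_Iio_ordinal]
    exact Cardinal.lift_le_aleph0.2 h
  rcases (Set.Iio α).eq_empty_or_nonempty with h | h
  · refine ⟨fun _ => 0, fun γ hγ => ?_⟩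
    have : γ ∈ Set.Iio α := hγ
    rw [h] at this
    exact absurd this (notMem_empty _)
  · obtain ⟨f, hf⟩ := hc.exists_eq_range h
    -- The unused first coordinate of the pairing makes each value recur at arbitrarily large
    -- indices.
    refine ⟨fun n => f n.unpair.2, fun γ hγ N => ?_⟩
    have : γ ∈ Set.range f := hf ▸ hγ
    obtain ⟨k, rfl⟩ := this
    exact ⟨Nat.pair N k, Nat.left_le_pair N k, by simp⟩

theorem corollary4p6 (α : Ordinal.{0}) (hα : α < Ordinal.omega 1) :
    ∃ (X : Type) (_ : MetricSpace X) (_ : CompactSpace X) (_ : Countable X) (T : X ≃ₜ X),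
      HasDerivedDegree X α ∧ HasVanDerWaerdenDepth T α ∧ HasBirkhoffDepth T α := by
  obtain ⟨ρ, hρ⟩ := exists_frequently_enumeration hα
  have h := isRecurrenceRank_configRank hρ
  refine ⟨configSpace ρ α, TopologicalSpace.metrizableSpaceMetric _,
    isCompact_iff_compactSpace.1 (isClosed_configSpace ρ α).isCompact,
    (countable_configSpace ρ α).to_subtype, configShift ρ α, h.hasDerivedDegree,
    h.hasVanDerWaerdenDepth, h.hasBirkhoffDepth⟩
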